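/- **Conventions.** Composition is written in diagrammatic order, and associators and unitors of monoidal categories are suppressed; $K$ is the unit and $\sigma$ the symmetry. An *additive symmetric monoidal category* is a symmetric monoidal category enriched in commutative monoids (each hom-set is a commutative monoid $(+,0)$; neither negatives nor biproducts are required) in which composition and $\otimes$ preserve $+$ and $0$ in each variable. A *coalgebra modality* $(!,\delta,\varepsilon,\Delta,e)$ is a comonad $(!,\delta,\varepsilon)$ with natural transformations $\Delta:!A\to !A\otimes !A$, $e:!A\to K$ making each $!A$ a cocommutative comonoid, with $\delta\Delta=\Delta(\delta\otimes\delta)$. A *monoidal coalgebra modality* $(!,\delta,\varepsilon,m_\otimes,m_K,\Delta,e)$ is a coalgebra modality together with a symmetric lax monoidal structure $m_\otimes:!A\otimes !B\to !(A\otimes B)$, $m_K:K\to !K$ on $!$ such that $\delta,\varepsilon,\Delta,e$ are monoidal transformations and $\Delta,e$ are $!$-coalgebra morphisms, i.e. $\delta\,!(\Delta)=\Delta(\delta\otimes\delta)m_\otimes$ and $\delta\,!(e)=e\,m_K$. An *additive linear category* is an additive symmetric monoidal category with a monoidal coalgebra modality. In it put $$\nabla:=(\delta\otimes\delta)\,m_\otimes\,!(\varepsilon\otimes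 e+e\otimes\varepsilon):!A\otimes !A\to !A,\qquad u:=m_K\,!(0):K\to !A .$$ An *additive bialgebra modality* is a coalgebra modality with natural transformations $\nabla:!A\otimes !A\to !A$, $u:K\to !A$ such that each $(!A,\nabla,u,\Delta,e)$ is a bialgebra with commutative multiplication, $\nabla\varepsilon=\varepsilon\otimes e+e\otimes\varepsilon$, $!(f+g)=\Delta(!(f)\otimes !(g))\nabla$ for all parallel maps $f,g$, and $!(0)=e\,u$. For a natural transformation $\mathsf d:!A\otimes A\to !A$ consider the rules * [d.1] $\mathsf d e=0$; * [d.2] $\mathsf d\Delta=(\Delta\otimes1)\big((1\otimes\mathsf d)+(1\otimes\sigma)(\mathsf d\otimes1)\big)$; * [d.3] $\mathsf d\varepsilon=e\otimes1$; * [d.4] $\mathsf d\delta=(\Delta\otimes1)(\delta\otimes\mathsf d)\mathsf d$; * [d.5] $(\mathsf d\otimes1)\mathsf d=(1\otimes\sigma)(\mathsf d\otimes1)\mathsf d$; * [d.$\nabla$] $(\nabla\otimes1)\mathsf d=(1\otimes\mathsf d)\nabla$; * [d.m] $(1\otimes\mathsf d)m_\otimes=(\Delta\otimes1\otimes1)(1\otimes\sigma\otimes1)(m_\otimes\otimes\varepsilon\otimes1)\mathsf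 d:\ !A\otimes !B\otimes B\to !(A\otimes B)$. A *deriving transformation* is such a $\mathsf d$ satisfying [d.1]–[d.5]; a *creation operator* (Fiore) is such a $\mathsf d$ satisfying [d.3], [d.4], [d.$\nabla$] and [d.m]. A *codereliction* is a natural transformation $\eta:A\to !A$ with $\eta e=0$, $\eta\Delta=\eta\otimes u+u\otimes\eta$, $\eta\varepsilon=1$ and $(1\otimes\eta)\nabla\delta=(\Delta\otimes\eta)(1\otimes\nabla)(\delta\otimes\eta)\nabla$. **Theorem.** In every additive linear category, $(!,\delta,\varepsilon,\Delta,e,\nabla,u)$, with the above $\nabla$ and $u$, is an additive bialgebra modality. Every deriving transformation $\mathsf d$ for the monoidal coalgebra modality satisfies the monoidal rule [d.m], and there is a unique codereliction $\eta$ for this induced additive bialgebra modality that induces it, i.e. $\mathsf d=(1\otimes\eta)\nabla$. Moreover, a family of maps $\mathsf d:!A\otimes A\to !A$ is a deriving transformation if and only if it is a creation operator. -/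

import Mathlib

open CategoryTheory MonoidalCategory

universe v u

namespace DiffCat

/-- A category enriched in commutative monoids: every hom-set is a commutative monoid and
composition is additive in each variable. Neither negatives nor biproducts are assumed. -/
class AdditiveCategory (C : Type u) [Category.{v} C] where
  homAddCommMonoid : ∀ X Y : C, AddCommMonoid (X ⟶ Y)
  add_comp : ∀ {X Y Z : C} (f g : X ⟶ Y) (h : Y ⟶ Z), (f + g) ≫ h = f ≫ h + g ≫ h
  comp_add : ∀ {X Y Z : C} (f : X ⟶ Y) (g h : Y ⟶ Z), f ≫ (g + h) = f ≫ g + f ≫ h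
  zero_comp : ∀ {X Y Z : C} (h : Y ⟶ Z), (0 : X ⟶ Y) ≫ h = 0
  comp_zero : ∀ {X Y Z : C} (f : X ⟶ Y), f ≫ (0 : Y ⟶ Z) = 0

attribute [reducible, instance] AdditiveCategory.homAddCommMonoid

/-- The tensor product of a monoidal category is compatible with the additive structure. -/
class AdditiveMonoidal (C : Type u) [Category.{v} C] [MonoidalCategory C]
    [AdditiveCategory C] : Prop where
  whiskerLeft_add : ∀ (X : C) {Y Z : C} (f g : Y ⟶ Z), X ◁ (f + g) = X ◁ f + X ◁ g
  add_whiskerRight : ∀ {Y Z : C} (f g : Y ⟶ Z) (X : C), (f + g) ▷ X = f ▷ X + g ▷ X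
  whiskerLeft_zero : ∀ (X Y Z : C), X ◁ (0 : Y ⟶ Z) = 0
  zero_whiskerRight : ∀ (X Y Z : C), (0 : Y ⟶ Z) ▷ X = 0

/-- A coalgebra modality `(!, δ, ε, Δ, e)`: a comonad such that every `! A` carries a natural
cocommutative comonoid structure whose comultiplication is preserved by `δ`. -/
structure CoalgebraModality (C : Type u) [Category.{v} C] [MonoidalCategory C]
    [SymmetricCategory C] extends Comonad C where
  Δ : ∀ A : C, obj A ⟶ obj A ⊗ obj A
  e : ∀ A : C, obj A ⟶ 𝟙_ C
  Δ_natural : ∀ {A B : C} (f : A ⟶ B), map f ≫ Δ B = Δ A ≫ (map f ⊗ₘ map f)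
  e_natural : ∀ {A B : C} (f : A ⟶ B), map f ≫ e B = e A
  Δ_coassoc : ∀ A : C, Δ A ≫ Δ A ▷ obj A ≫ (α_ _ _ _).hom = Δ A ≫ obj A ◁ Δ A
  e_Δ : ∀ A : C, Δ A ≫ e A ▷ obj A ≫ (λ_ _).hom = 𝟙 _
  Δ_e : ∀ A : C, Δ A ≫ obj A ◁ e A ≫ (ρ_ _).hom = 𝟙 _
  Δ_cocomm : ∀ A : C, Δ A ≫ (β_ _ _).hom = Δ A
  δ_Δ : ∀ A : C, δ.app A ≫ Δ (obj A) = Δ A ≫ (δ.app A ⊗ₘ δ.app A)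

open Functor.LaxMonoidal in
/-- A monoidal coalgebra modality `(!, δ, ε, m_⊗, m_K, Δ, e)`: a coalgebra modality whose
comonad is symmetric monoidal (`!` is a symmetric lax monoidal functor, with `m_⊗ = μ` and
`m_K = ε`, and `δ`, `ε` are monoidal transformations), such that `Δ` and `e` are
monoidal transformations and `!`-coalgebra morphisms. A symmetric monoidal category
together with such a structure is a linear category. -/
structure MonoidalCoalgebraModality (C : Type u) [Category.{v} C] [MonoidalCategory C]
    [SymmetricCategory C] extends CoalgebraModality C where
  laxBraided : toFunctor.LaxBraided
  δ_monoidal : NatTrans.IsMonoidal toComonad.δ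
  ε_monoidal : NatTrans.IsMonoidal toComonad.ε
  μ_Δ : ∀ A B : C, μ toFunctor A B ≫ Δ (A ⊗ B) =
    (Δ A ⊗ₘ Δ B) ≫ tensorμ (obj A) (obj A) (obj B) (obj B) ≫
      (μ toFunctor A B ⊗ₘ μ toFunctor A B)
  μ_e : ∀ A B : C, μ toFunctor A B ≫ e (A ⊗ B) = (e A ⊗ₘ e B) ≫ (λ_ (𝟙_ C)).hom
  unit_Δ : Functor.LaxMonoidal.ε toFunctor ≫ Δ (𝟙_ C) =
    (λ_ (𝟙_ C)).inv ≫
      (Functor.LaxMonoidal.ε toFunctor ⊗ₘ Functor.LaxMonoidal.ε toFunctor)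
  unit_e : Functor.LaxMonoidal.ε toFunctor ≫ e (𝟙_ C) = 𝟙 _
  Δ_coalg : ∀ A : C, toComonad.δ.app A ≫ map (Δ A) =
    Δ A ≫ (toComonad.δ.app A ⊗ₘ toComonad.δ.app A) ≫ μ toFunctor (obj A) (obj A)
  e_coalg : ∀ A : C, toComonad.δ.app A ≫ map (e A) =
    e A ≫ Functor.LaxMonoidal.ε toFunctor

attribute [instance] MonoidalCoalgebraModality.laxBraided

section

variable {C : Type u} [Category.{v} C] [MonoidalCategory C] [SymmetricCategory C]

/-- `m_⊗ : ! A ⊗ ! B ⟶ ! (A ⊗ B)`. -/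
abbrev MonoidalCoalgebraModality.mTensor (M : MonoidalCoalgebraModality C) (A B : C) :
    M.obj A ⊗ M.obj B ⟶ M.obj (A ⊗ B) :=
  Functor.LaxMonoidal.μ M.toFunctor A B

/-- `m_K : K ⟶ ! K`. -/
abbrev MonoidalCoalgebraModality.mUnit (M : MonoidalCoalgebraModality C) :
    𝟙_ C ⟶ M.obj (𝟙_ C) :=
  Functor.LaxMonoidal.ε M.toFunctor

variable [AdditiveCategory C]

/-- The map `ε ⊗ e + e ⊗ ε : ! A ⊗ ! A ⟶ A`. -/
def CoalgebraModality.εe (M : CoalgebraModality C) (A : C) : M.obj A ⊗ M.obj A ⟶ A :=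
  (M.ε.app A ⊗ₘ M.e A) ≫ (ρ_ A).hom + (M.e A ⊗ₘ M.ε.app A) ≫ (λ_ A).hom

/-- The induced multiplication
`∇ = (δ ⊗ δ) ; m_⊗ ; !(ε ⊗ e + e ⊗ ε) : ! A ⊗ ! A ⟶ ! A`. -/
def MonoidalCoalgebraModality.nabla (M : MonoidalCoalgebraModality C) (A : C) :
    M.obj A ⊗ M.obj A ⟶ M.obj A :=
  (M.δ.app A ⊗ₘ M.δ.app A) ≫ M.mTensor (M.obj A) (M.obj A) ≫ M.map (M.εe A)

/-- The induced unit `u = m_K ; !(0) : K ⟶ ! A`. -/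
def MonoidalCoalgebraModality.unit (M : MonoidalCoalgebraModality C) (A : C) :
    𝟙_ C ⟶ M.obj A :=
  M.mUnit ≫ M.map (0 : 𝟙_ C ⟶ A)

/-- `(!, δ, ε, Δ, e, ∇, u)` is a bialgebra modality. -/
structure IsBialgebraModality (M : CoalgebraModality C)
    (nab : ∀ A : C, M.obj A ⊗ M.obj A ⟶ M.obj A) (u : ∀ A : C, 𝟙_ C ⟶ M.obj A) : Prop where
  nab_natural : ∀ {A B : C} (f : A ⟶ B), (M.map f ⊗ₘ M.map f) ≫ nab B = nab A ≫ M.map f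
  u_natural : ∀ {A B : C} (f : A ⟶ B), u A ≫ M.map f = u B
  assoc : ∀ A : C, nab A ▷ M.obj A ≫ nab A = (α_ _ _ _).hom ≫ M.obj A ◁ nab A ≫ nab A
  u_nab : ∀ A : C, (λ_ _).inv ≫ u A ▷ M.obj A ≫ nab A = 𝟙 _
  nab_u : ∀ A : C, (ρ_ _).inv ≫ M.obj A ◁ u A ≫ nab A = 𝟙 _
  comm : ∀ A : C, (β_ _ _).hom ≫ nab A = nab A
  nab_e : ∀ A : C, nab A ≫ M.e A = (M.e A ⊗ₘ M.e A) ≫ (λ_ (𝟙_ C)).hom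
  u_Δ : ∀ A : C, u A ≫ M.Δ A = (λ_ (𝟙_ C)).inv ≫ (u A ⊗ₘ u A)
  u_e : ∀ A : C, u A ≫ M.e A = 𝟙 _
  nab_Δ : ∀ A : C, nab A ≫ M.Δ A =
    (M.Δ A ⊗ₘ M.Δ A) ≫ tensorμ (M.obj A) (M.obj A) (M.obj A) (M.obj A) ≫ (nab A ⊗ₘ nab A)
  nab_ε : ∀ A : C, nab A ≫ M.ε.app A = M.εe A

/-- `(!, δ, ε, Δ, e, ∇, u)` is an additive bialgebra modality. -/
structure IsAdditiveBialgebraModality (M : CoalgebraModality C)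
    (nab : ∀ A : C, M.obj A ⊗ M.obj A ⟶ M.obj A) (u : ∀ A : C, 𝟙_ C ⟶ M.obj A) : Prop
    extends IsBialgebraModality M nab u where
  map_add : ∀ {A B : C} (f g : A ⟶ B),
    M.map (f + g) = M.Δ A ≫ (M.map f ⊗ₘ M.map g) ≫ nab B
  map_zero : ∀ A B : C, M.map (0 : A ⟶ B) = M.e A ≫ u B

section Rules

/-! Rules for a family of maps `d_A : ! A ⊗ A ⟶ ! A`. -/

variable (M : CoalgebraModality C) (d : ∀ A : C, M.obj A ⊗ A ⟶ M.obj A)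

/-- Naturality of `d`. -/
def DNatural : Prop :=
  ∀ {A B : C} (f : A ⟶ B), (M.map f ⊗ₘ f) ≫ d B = d A ≫ M.map f

/-- [d.1] -/
def ConstantRule : Prop :=
  ∀ A : C, d A ≫ M.e A = 0

/-- [d.2] -/
def LeibnizRule : Prop :=
  ∀ A : C, d A ≫ M.Δ A =
    M.Δ A ▷ A ≫ (α_ _ _ _).hom ≫
      (M.obj A ◁ d A + M.obj A ◁ (β_ (M.obj A) A).hom ≫ (α_ _ _ _).inv ≫ d A ▷ M.obj A)

/-- [d.3] -/
def LinearRule : Prop :=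
  ∀ A : C, d A ≫ M.ε.app A = M.e A ▷ A ≫ (λ_ A).hom

/-- [d.4] -/
def ChainRule : Prop :=
  ∀ A : C, d A ≫ M.δ.app A =
    M.Δ A ▷ A ≫ (α_ _ _ _).hom ≫ (M.δ.app A ⊗ₘ d A) ≫ d (M.obj A)

/-- [d.5] -/
def InterchangeRule : Prop :=
  ∀ A : C, d A ▷ A ≫ d A =
    (α_ _ _ _).hom ≫ M.obj A ◁ (β_ A A).hom ≫ (α_ _ _ _).inv ≫ d A ▷ A ≫ d A

/-- [d.∇] -/
def NablaRule (nab : ∀ A : C, M.obj A ⊗ M.obj A ⟶ M.obj A) : Prop :=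
  ∀ A : C, nab A ▷ A ≫ d A = (α_ _ _ _).hom ≫ M.obj A ◁ d A ≫ nab A

/-- A deriving transformation for a coalgebra modality. -/
structure IsDerivingTransformation : Prop where
  natural : DNatural M d
  constant : ConstantRule M d
  leibniz : LeibnizRule M d
  linear : LinearRule M d
  chain : ChainRule M d
  interchange : InterchangeRule M d

end Rules

/-- [d.m], both sides being maps `! A ⊗ (! B ⊗ B) ⟶ ! (A ⊗ B)`. -/
def MonoidalRule (M : MonoidalCoalgebraModality C)
    (d : ∀ A : C, M.obj A ⊗ A ⟶ M.obj A) : Prop :=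
  ∀ A B : C, M.obj A ◁ d B ≫ M.mTensor A B =
    M.Δ A ▷ (M.obj B ⊗ B) ≫ tensorμ (M.obj A) (M.obj A) (M.obj B) B ≫
      (M.mTensor A B ⊗ₘ (M.ε.app A ▷ B)) ≫ d (A ⊗ B)

/-- A creation operator in the sense of Fiore for a monoidal coalgebra modality. -/
structure IsCreationOperator (M : MonoidalCoalgebraModality C)
    (d : ∀ A : C, M.obj A ⊗ A ⟶ M.obj A) : Prop where
  natural : DNatural M.toCoalgebraModality d
  linear : LinearRule M.toCoalgebraModality d
  chain : ChainRule M.toCoalgebraModality d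
  nabla : NablaRule M.toCoalgebraModality d M.nabla
  monoidal : MonoidalRule M d

/-- A codereliction `η_A : A ⟶ ! A` with respect to `∇` and `u`. -/
structure IsCodereliction (M : CoalgebraModality C)
    (nab : ∀ A : C, M.obj A ⊗ M.obj A ⟶ M.obj A) (u : ∀ A : C, 𝟙_ C ⟶ M.obj A)
    (η : ∀ A : C, A ⟶ M.obj A) : Prop where
  natural : ∀ {A B : C} (f : A ⟶ B), f ≫ η B = η A ≫ M.map f
  constant : ∀ A : C, η A ≫ M.e A = 0
  product : ∀ A : C, η A ≫ M.Δ A =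
    (ρ_ A).inv ≫ (η A ⊗ₘ u A) + (λ_ A).inv ≫ (u A ⊗ₘ η A)
  linear : ∀ A : C, η A ≫ M.ε.app A = 𝟙 A
  chain : ∀ A : C, M.obj A ◁ η A ≫ nab A ≫ M.δ.app A =
    (M.Δ A ⊗ₘ η A) ≫ (α_ _ _ _).hom ≫ M.obj A ◁ nab A ≫
      (M.δ.app A ⊗ₘ η (M.obj A)) ≫ nab (M.obj A)

end

end DiffCat

namespace DiffCat

open Functor.LaxMonoidal

/-! ### Additivity of the tensor product. -/

section Additive

variable {C : Type u} [Category.{v} C] [MonoidalCategory C] [AdditiveCategory C]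
  [AdditiveMonoidal C]

/-! Two facts carry everything. A coalgebra morphism into a cofree coalgebra is determined by its
composite with ε (`IsCoalgHom.cofree_ext`). And `!A ⊗ !B` behaves like a product of cofree
coalgebras, hence as a substitute for `!(A ⊕ B)`: it is a retract of `!(!A ⊗ !B)` by way of the
projections `ε ⊗ e` and `e ⊗ ε` (`pairCoalg_split`).

The multiplication ∇ is a coalgebra morphism whose composite with ε is the sum of the projections,
so equations between maps into `!A` reduce to linear ones. Compatibility with Δ and e holds because
∇ and u are composites of comonoid morphisms.

For a deriving transformation, put `η = (u ⊗ 1)d` and differentiate on `!A ⊗ !B` in the direction `u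
⊗ η`, whose projections are 0 and 1. One Leibniz term dies, and the retraction identifies the other
with `1 ⊗ d` (`pairCoalg_inclSnd_deriv`). Following this identity by ∇ gives [d.∇]; following it by
m_⊗ and using the chain rule gives [d.m].

Conversely, [d.∇] gives `d = (1 ⊗ η)∇`, so the remaining rules become bialgebra identities about η.
The only delicate one, the product rule for η, follows from additivity and naturality applied to `η
⊗ u + u ⊗ η` (`inducedEta_Δ`). -/

theorem tensorHom_zero {A B X Y : C} (f : A ⟶ B) : f ⊗ₘ (0 : X ⟶ Y) = 0 := by
  rw [MonoidalCategory.tensorHom_def, AdditiveMonoidal.whiskerLeft_zero, AdditiveCategory.comp_zero]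

theorem zero_tensorHom {A B X Y : C} (f : A ⟶ B) : (0 : X ⟶ Y) ⊗ₘ f = 0 := by
  rw [MonoidalCategory.tensorHom_def, AdditiveMonoidal.zero_whiskerRight, AdditiveCategory.zero_comp]

theorem tensorHom_add {A B X Y : C} (f : A ⟶ B) (g h : X ⟶ Y) :
    f ⊗ₘ (g + h) = f ⊗ₘ g + f ⊗ₘ h := by
  simp only [MonoidalCategory.tensorHom_def, AdditiveMonoidal.whiskerLeft_add,
    AdditiveCategory.comp_add]

theorem add_tensorHom {A B X Y : C} (f : A ⟶ B) (g h : X ⟶ Y) :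
    (g + h) ⊗ₘ f = g ⊗ₘ f + h ⊗ₘ f := by
  simp only [MonoidalCategory.tensorHom_def, AdditiveMonoidal.add_whiskerRight,
    AdditiveCategory.add_comp]

end Additive

variable {C : Type u} [Category.{v} C] [MonoidalCategory C] [SymmetricCategory C]

/-- The comultiplication `δ : !A ⟶ !!A`. -/
def MonoidalCoalgebraModality.dig (M : MonoidalCoalgebraModality C) (A : C) :
    M.obj A ⟶ M.obj (M.obj A) := M.δ.app A

/-- The counit `ε : !A ⟶ A`. -/
def MonoidalCoalgebraModality.der (M : MonoidalCoalgebraModality C) (A : C) :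
    M.obj A ⟶ A := M.ε.app A

/-! ### Coalgebras of the comonad and their morphisms. -/

section Coalgebra

variable (M : MonoidalCoalgebraModality C)

/-- `f : X ⟶ Y` commutes with the `!`-costructure maps `x` and `y`. -/
def IsCoalgHom {X Y : C} (x : X ⟶ M.obj X) (y : Y ⟶ M.obj Y) (f : X ⟶ Y) : Prop :=
  x ≫ M.map f = f ≫ y

/-- The tensor product of two `!`-costructure maps. -/
def tensorCoalg {X Y : C} (x : X ⟶ M.obj X) (y : Y ⟶ M.obj Y) : X ⊗ Y ⟶ M.obj (X ⊗ Y) :=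
  (x ⊗ₘ y) ≫ M.mTensor X Y

variable {M}

theorem mTensor_dig (A B : C) : M.mTensor A B ≫ M.dig (A ⊗ B) =
    (M.dig A ⊗ₘ M.dig B) ≫ M.mTensor (M.obj A) (M.obj B) ≫ M.map (M.mTensor A B) := by
  simpa [MonoidalCoalgebraModality.dig] using M.δ_monoidal.tensor A B

theorem mUnit_dig : M.mUnit ≫ M.dig (𝟙_ C) = M.mUnit ≫ M.map M.mUnit := by
  simpa [MonoidalCoalgebraModality.dig] using M.δ_monoidal.unit

theorem mTensor_der (A B : C) :
    M.mTensor A B ≫ M.der (A ⊗ B) = M.der A ⊗ₘ M.der B := by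
  simpa [MonoidalCoalgebraModality.der] using M.ε_monoidal.tensor A B

theorem map_tensorHom_mTensor {A A' B B' : C} (f : A ⟶ A') (g : B ⟶ B') :
    (M.map f ⊗ₘ M.map g) ≫ M.mTensor A' B' = M.mTensor A B ≫ M.map (f ⊗ₘ g) :=
  μ_natural M.toFunctor f g

theorem dig_map_der (A : C) : M.dig A ≫ M.map (M.der A) = 𝟙 _ := M.right_counit A

theorem dig_der (A : C) : M.dig A ≫ M.der (M.obj A) = 𝟙 _ := M.left_counit A

theorem map_der {A B : C} (f : A ⟶ B) : M.map f ≫ M.der B = M.der A ≫ f :=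
  M.ε.naturality f

theorem map_dig {A B : C} (f : A ⟶ B) : M.map f ≫ M.dig B = M.dig A ≫ M.map (M.map f) :=
  M.δ.naturality f

theorem dig_Δ (A : C) : M.dig A ≫ M.Δ (M.obj A) = M.Δ A ≫ (M.dig A ⊗ₘ M.dig A) := M.δ_Δ A

theorem dig_map_e (A : C) : M.dig A ≫ M.map (M.e A) = M.e A ≫ M.mUnit := M.e_coalg A

theorem dig_e (A : C) : M.dig A ≫ M.e (M.obj A) = M.e A := by
  rw [← M.e_natural (M.der A), ← Category.assoc, dig_map_der, Category.id_comp]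

namespace IsCoalgHom

variable {X Y Z X' Y' : C} {x : X ⟶ M.obj X} {y : Y ⟶ M.obj Y} {z : Z ⟶ M.obj Z}
  {x' : X' ⟶ M.obj X'} {y' : Y' ⟶ M.obj Y'}

theorem id : IsCoalgHom M x x (𝟙 X) := by
  rw [IsCoalgHom, M.map_id, Category.comp_id, Category.id_comp]

theorem comp {f : X ⟶ Y} {g : Y ⟶ Z} (hf : IsCoalgHom M x y f) (hg : IsCoalgHom M y z g) :
    IsCoalgHom M x z (f ≫ g) := by
  rw [IsCoalgHom] at *
  rw [M.map_comp, ← Category.assoc, hf, Category.assoc, hg, Category.assoc]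

theorem tensor {f : X ⟶ X'} {g : Y ⟶ Y'} (hf : IsCoalgHom M x x' f)
    (hg : IsCoalgHom M y y' g) :
    IsCoalgHom M (tensorCoalg M x y) (tensorCoalg M x' y') (f ⊗ₘ g) := by
  rw [IsCoalgHom] at *
  rw [tensorCoalg, tensorCoalg, Category.assoc, ← map_tensorHom_mTensor,
    tensorHom_comp_tensorHom_assoc, hf, hg, tensorHom_comp_tensorHom_assoc]

theorem associator : IsCoalgHom M (tensorCoalg M (tensorCoalg M x y) z)
    (tensorCoalg M x (tensorCoalg M y z)) (α_ X Y Z).hom := by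
  have h := Functor.LaxMonoidal.associativity M.toFunctor X Y Z
  have e1 : ((x ⊗ₘ y) ≫ M.mTensor X Y) ⊗ₘ z =
      ((x ⊗ₘ y) ⊗ₘ z) ≫ M.mTensor X Y ▷ M.obj Z := by
    rw [← tensorHom_id, tensorHom_comp_tensorHom, Category.comp_id]
  have e2 : x ⊗ₘ ((y ⊗ₘ z) ≫ M.mTensor Y Z) =
      (x ⊗ₘ (y ⊗ₘ z)) ≫ M.obj X ◁ M.mTensor Y Z := by
    rw [← id_tensorHom, tensorHom_comp_tensorHom, Category.comp_id]
  rw [IsCoalgHom, tensorCoalg, tensorCoalg, tensorCoalg, tensorCoalg, e1, e2]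
  simp only [Category.assoc]
  rw [h, associator_naturality_assoc]

theorem braiding : IsCoalgHom M (tensorCoalg M x y) (tensorCoalg M y x) (β_ X Y).hom := by
  rw [IsCoalgHom, tensorCoalg, tensorCoalg, Category.assoc, Functor.LaxBraided.braided,
    BraidedCategory.braiding_naturality_assoc]

theorem leftUnitor_inv : IsCoalgHom M x (tensorCoalg M M.mUnit x) (λ_ X).inv := by
  rw [IsCoalgHom, tensorCoalg, ← left_unitality_inv, MonoidalCategory.tensorHom_def',
    Category.assoc, ← leftUnitor_inv_naturality_assoc]

theorem map {A B : C} (f : A ⟶ B) : IsCoalgHom M (M.dig A) (M.dig B) (M.map f) :=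
  (map_dig f).symm

theorem dig (A : C) : IsCoalgHom M (M.dig A) (M.dig (M.obj A)) (M.dig A) := M.coassoc A

theorem mTensor (A B : C) : IsCoalgHom M (tensorCoalg M (M.dig A) (M.dig B))
    (M.dig (A ⊗ B)) (M.mTensor A B) := by
  rw [IsCoalgHom, mTensor_dig, tensorCoalg, Category.assoc]

theorem mUnit : IsCoalgHom M M.mUnit (M.dig (𝟙_ C)) M.mUnit := mUnit_dig.symm

theorem Δ (A : C) : IsCoalgHom M (M.dig A) (tensorCoalg M (M.dig A) (M.dig A)) (M.Δ A) :=
  M.Δ_coalg A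

theorem e (A : C) : IsCoalgHom M (M.dig A) M.mUnit (M.e A) := M.e_coalg A

/-- A coalgebra morphism into a cofree coalgebra is determined by its composite with `ε`. -/
theorem cofree_ext {A : C} {f g : X ⟶ M.obj A} (hf : IsCoalgHom M x (M.dig A) f)
    (hg : IsCoalgHom M x (M.dig A) g) (h : f ≫ M.der A = g ≫ M.der A) : f = g := by
  -- Only the morphism equation and `δ !(ε) = 1` enter, so `x` need not satisfy any coalgebra law.
  have key : ∀ {k : X ⟶ M.obj A}, IsCoalgHom M x (M.dig A) k →
      k = x ≫ M.map (k ≫ M.der A) := fun {k} hk => by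
    rw [IsCoalgHom] at hk
    rw [M.map_comp, ← Category.assoc, hk, Category.assoc, dig_map_der, Category.comp_id]
  rw [key hf, key hg, h]

end IsCoalgHom

/-! ### The coalgebra `!A ⊗ !B` as a product. -/

/-- The canonical costructure map `!A ⊗ !B ⟶ !(!A ⊗ !B)`. -/
abbrev pairCoalg (M : MonoidalCoalgebraModality C) (A B : C) :
    M.obj A ⊗ M.obj B ⟶ M.obj (M.obj A ⊗ M.obj B) :=
  tensorCoalg M (M.dig A) (M.dig B)

/-- The canonical costructure map on `!A ⊗ !B` is coassociative. -/
theorem isCoalgHom_pairCoalg (A B : C) :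
    IsCoalgHom M (pairCoalg M A B) (M.dig _) (pairCoalg M A B) :=
  ((IsCoalgHom.dig A).tensor (IsCoalgHom.dig B)).comp (IsCoalgHom.mTensor _ _)

theorem pairCoalg_der (A B : C) : pairCoalg M A B ≫ M.der _ = 𝟙 _ := by
  rw [pairCoalg, tensorCoalg, Category.assoc, mTensor_der, tensorHom_comp_tensorHom, dig_der,
    dig_der, id_tensorHom_id]

/-- The first projection `ε ⊗ e : !A ⊗ !B ⟶ A`. -/
def projFst (M : MonoidalCoalgebraModality C) (A B : C) : M.obj A ⊗ M.obj B ⟶ A :=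
  (M.der A ⊗ₘ M.e B) ≫ (ρ_ A).hom

/-- The second projection `e ⊗ ε : !A ⊗ !B ⟶ B`. -/
def projSnd (M : MonoidalCoalgebraModality C) (A B : C) : M.obj A ⊗ M.obj B ⟶ B :=
  (M.e A ⊗ₘ M.der B) ≫ (λ_ B).hom

theorem pairCoalg_map_projFst (A B : C) :
    pairCoalg M A B ≫ M.map (projFst M A B) = M.obj A ◁ M.e B ≫ (ρ_ _).hom := by
  rw [pairCoalg, tensorCoalg, projFst, Category.assoc, M.map_comp,
    ← reassoc_of% (map_tensorHom_mTensor (M := M)), tensorHom_comp_tensorHom_assoc, dig_map_der,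
    dig_map_e, ← id_tensorHom, Functor.LaxMonoidal.right_unitality M.toFunctor A,
    ← id_tensorHom, tensorHom_comp_tensorHom_assoc, Category.comp_id]

theorem pairCoalg_map_projSnd (A B : C) :
    pairCoalg M A B ≫ M.map (projSnd M A B) = M.e A ▷ M.obj B ≫ (λ_ _).hom := by
  rw [pairCoalg, tensorCoalg, projSnd, Category.assoc, M.map_comp,
    ← reassoc_of% (map_tensorHom_mTensor (M := M)), tensorHom_comp_tensorHom_assoc, dig_map_der,
    dig_map_e, ← tensorHom_id, Functor.LaxMonoidal.left_unitality M.toFunctor B,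
    ← tensorHom_id, tensorHom_comp_tensorHom_assoc, Category.comp_id]

/-- Both δ and m_⊗ preserve comultiplication, so the costructure map is a comonoid morphism. -/
theorem pairCoalg_Δ (A B : C) : pairCoalg M A B ≫ M.Δ _ =
    (M.Δ A ⊗ₘ M.Δ B) ≫ tensorμ (M.obj A) (M.obj A) (M.obj B) (M.obj B) ≫
      (pairCoalg M A B ⊗ₘ pairCoalg M A B) := by
  rw [pairCoalg, tensorCoalg, Category.assoc, M.μ_Δ, tensorHom_comp_tensorHom_assoc, dig_Δ,
    dig_Δ, ← tensorHom_comp_tensorHom, Category.assoc, tensorμ_natural_assoc,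
    tensorHom_comp_tensorHom]

theorem pairCoalg_e (A B : C) :
    pairCoalg M A B ≫ M.e _ = (M.e A ⊗ₘ M.e B) ≫ (λ_ (𝟙_ C)).hom := by
  rw [pairCoalg, tensorCoalg, Category.assoc, M.μ_e, tensorHom_comp_tensorHom_assoc, dig_e, dig_e]

theorem tensorμ_unit_unit (A B : C) :
    tensorμ A (𝟙_ C) (𝟙_ C) B ≫ ((ρ_ A).hom ⊗ₘ (λ_ B).hom) = (ρ_ A).hom ⊗ₘ (λ_ B).hom := by
  rw [tensorμ, braiding_tensorUnit_left]
  monoidal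

/-- `!A ⊗ !B` is recovered from `!(!A ⊗ !B)` through the two projections. -/
theorem pairCoalg_split (A B : C) : pairCoalg M A B ≫ M.Δ _ ≫
    (M.map (projFst M A B) ⊗ₘ M.map (projSnd M A B)) = 𝟙 _ := by
  rw [reassoc_of% pairCoalg_Δ (M := M) A B, tensorHom_comp_tensorHom, pairCoalg_map_projFst,
    pairCoalg_map_projSnd, ← tensorHom_comp_tensorHom, ← id_tensorHom, ← tensorHom_id,
    ← tensorμ_natural_assoc, tensorμ_unit_unit, tensorHom_comp_tensorHom_assoc,
    tensorHom_comp_tensorHom]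
  simp only [id_tensorHom, tensorHom_id, Category.assoc, M.e_Δ, M.Δ_e, id_whiskerRight]

theorem map_projFst_comp {A B A' B' : C} (f : A ⟶ A') (g : B ⟶ B') :
    (M.map f ⊗ₘ M.map g) ≫ projFst M A' B' = projFst M A B ≫ f := by
  rw [projFst, projFst, tensorHom_comp_tensorHom_assoc, map_der, M.e_natural, Category.assoc,
    ← rightUnitor_naturality, ← tensorHom_id, tensorHom_comp_tensorHom_assoc, Category.comp_id]

theorem map_projSnd_comp {A B A' B' : C} (f : A ⟶ A') (g : B ⟶ B') :
    (M.map f ⊗ₘ M.map g) ≫ projSnd M A' B' = projSnd M A B ≫ g := by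
  rw [projSnd, projSnd, tensorHom_comp_tensorHom_assoc, map_der, M.e_natural, Category.assoc,
    ← leftUnitor_naturality, ← id_tensorHom, tensorHom_comp_tensorHom_assoc, Category.comp_id]

theorem Δ_projFst (A : C) : M.Δ A ≫ projFst M A A = M.der A := by
  have h : projFst M A A = M.obj A ◁ M.e A ≫ (ρ_ _).hom ≫ M.der A := by
    rw [projFst, ← rightUnitor_naturality, MonoidalCategory.tensorHom_def', Category.assoc]
  rw [h, reassoc_of% M.Δ_e A]

theorem Δ_projSnd (A : C) : M.Δ A ≫ projSnd M A A = M.der A := by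
  have h : projSnd M A A = M.e A ▷ M.obj A ≫ (λ_ _).hom ≫ M.der A := by
    rw [projSnd, ← leftUnitor_naturality, MonoidalCategory.tensorHom_def, Category.assoc]
  rw [h, reassoc_of% M.e_Δ A]

/-- Both sides are coalgebra morphisms into a cofree coalgebra. Trading m_⊗ for δ followed by a map
in the image of `!` is what makes the chain rule and naturality of `d` applicable in [d.m]. -/
theorem Δ_mTensor {A B X : C} (f : X ⟶ A) (g : X ⟶ B) :
    M.Δ X ≫ (M.map f ⊗ₘ M.map g) ≫ M.mTensor A B =
      M.dig X ≫ M.map (M.Δ X ≫ (M.map f ⊗ₘ M.map g) ≫ (M.der A ⊗ₘ M.der B)) := by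
  apply ((IsCoalgHom.Δ X).comp (((IsCoalgHom.map f).tensor (IsCoalgHom.map g)).comp
    (IsCoalgHom.mTensor A B))).cofree_ext ((IsCoalgHom.dig X).comp (IsCoalgHom.map _))
  rw [Category.assoc, Category.assoc, mTensor_der, Category.assoc, map_der, ← Category.assoc
    (M.dig X), dig_der, Category.id_comp]

theorem tensorμ_counit (A B B' : C) :
    ((A ⊗ A) ◁ (ρ_ B).inv ≫ tensorμ A A B (𝟙_ C)) ▷ B' ≫ (α_ _ _ _).hom ≫
      (A ⊗ B) ◁ ((α_ _ _ _).hom ≫ A ◁ (λ_ B').hom) =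
    (α_ _ _ _).hom ≫ tensorμ A A B B' := by
  rw [tensorμ, tensorμ]
  monoidal

/-- The counit law of `!B` cancels the copy of B produced by its comultiplication. This is the last
simplification in [d.m], where the linear rule has introduced that `e`. -/
theorem Δ_tensor_counit (A B B' : C) :
    ((M.Δ A ⊗ₘ M.Δ B) ≫ tensorμ (M.obj A) (M.obj A) (M.obj B) (M.obj B)) ▷ B' ≫
      (α_ _ _ _).hom ≫ (M.mTensor A B ⊗ₘ ((α_ _ _ _).hom ≫
        (M.der A ⊗ₘ (M.e B ▷ B' ≫ (λ_ B').hom)))) =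
    (α_ _ _ _).hom ≫ M.Δ A ▷ (M.obj B ⊗ B') ≫ tensorμ (M.obj A) (M.obj A) (M.obj B) B' ≫
      (M.mTensor A B ⊗ₘ M.der A ▷ B') := by
  have e1 : M.mTensor A B ⊗ₘ ((α_ _ _ _).hom ≫ (M.der A ⊗ₘ (M.e B ▷ B' ≫ (λ_ B').hom))) =
      (M.obj A ⊗ M.obj B) ◁ ((M.obj A ◁ M.e B) ▷ B') ≫
        (M.obj A ⊗ M.obj B) ◁ ((α_ _ _ _).hom ≫ M.obj A ◁ (λ_ B').hom) ≫
          (M.mTensor A B ⊗ₘ M.der A ▷ B') := by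
    rw [MonoidalCategory.tensorHom_def', MonoidalCategory.tensorHom_def' (M.der A),
      MonoidalCategory.tensorHom_def' (M.mTensor A B) (M.der A ▷ B')]
    monoidal
  have e2 : (M.Δ A ⊗ₘ M.Δ B) ≫ tensorμ (M.obj A) (M.obj A) (M.obj B) (M.obj B) ≫
      (M.obj A ⊗ M.obj B) ◁ (M.obj A ◁ M.e B) =
      M.Δ A ▷ M.obj B ≫ (M.obj A ⊗ M.obj A) ◁ (ρ_ _).inv ≫
        tensorμ (M.obj A) (M.obj A) (M.obj B) (𝟙_ C) := by
    have h : M.Δ B ≫ M.obj B ◁ M.e B = (ρ_ _).inv := by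
      rw [← cancel_mono (ρ_ _).hom, Category.assoc, M.Δ_e, Iso.inv_hom_id]
    rw [← id_tensorHom, ← id_tensorHom_id, ← id_tensorHom, ← tensorμ_natural, ← h,
      id_tensorHom_id, tensorHom_comp_tensorHom_assoc, Category.comp_id,
      MonoidalCategory.tensorHom_def, Category.assoc, id_tensorHom]
  rw [e1, ← associator_naturality_middle_assoc, ← comp_whiskerRight_assoc, Category.assoc, e2,
    comp_whiskerRight_assoc, reassoc_of% tensorμ_counit (M.obj A) (M.obj B) B',
    associator_naturality_left_assoc]

end Coalgebra

end DiffCat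

/-! ### The induced additive bialgebra structure. -/

namespace DiffCat

section Bialgebra

variable {C : Type u} [Category.{v} C] [MonoidalCategory C] [SymmetricCategory C]
  [AdditiveCategory C] {M : MonoidalCoalgebraModality C}

theorem nabla_eq (A : C) :
    M.nabla A = pairCoalg M A A ≫ M.map (projFst M A A + projSnd M A A) :=
  (Category.assoc _ _ _).symm

/-- Together with `nabla_der`, this characterises ∇ as the coalgebra morphism lifting the sum of the
projections, and makes `IsCoalgHom.cofree_ext` available for its algebraic laws. -/
theorem isCoalgHom_nabla (A : C) : IsCoalgHom M (pairCoalg M A A) (M.dig A) (M.nabla A) := by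
  rw [nabla_eq]
  exact (isCoalgHom_pairCoalg A A).comp (IsCoalgHom.map _)

theorem isCoalgHom_unit (A : C) : IsCoalgHom M M.mUnit (M.dig A) (M.unit A) :=
  IsCoalgHom.mUnit.comp (IsCoalgHom.map _)

theorem nabla_der (A : C) : M.nabla A ≫ M.der A = projFst M A A + projSnd M A A := by
  rw [nabla_eq, Category.assoc, map_der, ← Category.assoc, pairCoalg_der, Category.id_comp]

theorem unit_der (A : C) : M.unit A ≫ M.der A = 0 := by
  rw [MonoidalCoalgebraModality.unit, Category.assoc, map_der, AdditiveCategory.comp_zero,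
    AdditiveCategory.comp_zero]

theorem nabla_e (A : C) : M.nabla A ≫ M.e A = (M.e A ⊗ₘ M.e A) ≫ (λ_ (𝟙_ C)).hom := by
  rw [nabla_eq, Category.assoc, M.e_natural, pairCoalg_e]

theorem unit_e (A : C) : M.unit A ≫ M.e A = 𝟙 _ := by
  rw [MonoidalCoalgebraModality.unit, Category.assoc, M.e_natural, M.unit_e]

theorem unit_Δ (A : C) : M.unit A ≫ M.Δ A = (λ_ (𝟙_ C)).inv ≫ (M.unit A ⊗ₘ M.unit A) := by
  rw [MonoidalCoalgebraModality.unit, Category.assoc, M.Δ_natural, reassoc_of% M.unit_Δ,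
    tensorHom_comp_tensorHom]

theorem nabla_Δ (A : C) : M.nabla A ≫ M.Δ A = (M.Δ A ⊗ₘ M.Δ A) ≫
    tensorμ (M.obj A) (M.obj A) (M.obj A) (M.obj A) ≫ (M.nabla A ⊗ₘ M.nabla A) := by
  rw [nabla_eq, Category.assoc, M.Δ_natural, reassoc_of% pairCoalg_Δ (M := M) A A,
    tensorHom_comp_tensorHom]

theorem unit_natural {A B : C} (f : A ⟶ B) : M.unit A ≫ M.map f = M.unit B := by
  rw [MonoidalCoalgebraModality.unit, Category.assoc, ← M.map_comp,
    AdditiveCategory.zero_comp, MonoidalCoalgebraModality.unit]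

theorem map_zero_eq (A B : C) : M.map (0 : A ⟶ B) = M.e A ≫ M.unit B := by
  apply (IsCoalgHom.map (M := M) (0 : A ⟶ B)).cofree_ext
    ((IsCoalgHom.e A).comp (isCoalgHom_unit B))
  rw [map_der, AdditiveCategory.comp_zero, Category.assoc, unit_der, AdditiveCategory.comp_zero]

theorem nabla_natural {A B : C} (f : A ⟶ B) :
    (M.map f ⊗ₘ M.map f) ≫ M.nabla B = M.nabla A ≫ M.map f := by
  apply (((IsCoalgHom.map f).tensor (IsCoalgHom.map f)).comp (isCoalgHom_nabla B)).cofree_ext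
    ((isCoalgHom_nabla A).comp (IsCoalgHom.map f))
  rw [Category.assoc, nabla_der, Category.assoc, map_der, AdditiveCategory.comp_add,
    map_projFst_comp, map_projSnd_comp, ← Category.assoc, nabla_der, AdditiveCategory.add_comp]

theorem map_add_eq {A B : C} (f g : A ⟶ B) :
    M.map (f + g) = M.Δ A ≫ (M.map f ⊗ₘ M.map g) ≫ M.nabla B := by
  apply (IsCoalgHom.map (M := M) (f + g)).cofree_ext ((IsCoalgHom.Δ A).comp
    (((IsCoalgHom.map f).tensor (IsCoalgHom.map g)).comp (isCoalgHom_nabla B)))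
  rw [map_der, Category.assoc, Category.assoc, nabla_der, AdditiveCategory.comp_add,
    AdditiveCategory.comp_add, map_projFst_comp, map_projSnd_comp, AdditiveCategory.comp_add,
    reassoc_of% Δ_projFst (M := M) A, reassoc_of% Δ_projSnd (M := M) A]

theorem nabla_comm (A : C) : (β_ _ _).hom ≫ M.nabla A = M.nabla A := by
  apply (IsCoalgHom.braiding.comp (isCoalgHom_nabla A)).cofree_ext (isCoalgHom_nabla A)
  rw [Category.assoc, nabla_der, AdditiveCategory.comp_add, add_comm, projFst, projSnd,
    ← BraidedCategory.braiding_naturality_assoc, braiding_leftUnitor,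
    ← BraidedCategory.braiding_naturality_assoc, braiding_rightUnitor]

variable [AdditiveMonoidal C]

theorem unit_nabla (A : C) : (λ_ _).inv ≫ M.unit A ▷ M.obj A ≫ M.nabla A = 𝟙 _ := by
  rw [← tensorHom_id]
  apply (IsCoalgHom.leftUnitor_inv.comp (((isCoalgHom_unit A).tensor
    IsCoalgHom.id).comp (isCoalgHom_nabla A))).cofree_ext (IsCoalgHom.id (x := M.dig A))
  rw [Category.assoc, Category.assoc, nabla_der, AdditiveCategory.comp_add, projFst, projSnd,
    tensorHom_comp_tensorHom_assoc, tensorHom_comp_tensorHom_assoc, unit_der, unit_e,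
    zero_tensorHom, AdditiveCategory.zero_comp, zero_add, Category.id_comp,
    id_tensorHom, leftUnitor_naturality, Iso.inv_hom_id_assoc]

theorem nabla_unit (A : C) : (ρ_ _).inv ≫ M.obj A ◁ M.unit A ≫ M.nabla A = 𝟙 _ := by
  rw [← nabla_comm, BraidedCategory.braiding_naturality_right_assoc, ← unit_nabla,
    braiding_tensorUnit_right, Category.assoc, Iso.inv_hom_id_assoc]

theorem nabla_assoc (A : C) : M.nabla A ▷ M.obj A ≫ M.nabla A =
    (α_ _ _ _).hom ≫ M.obj A ◁ M.nabla A ≫ M.nabla A := by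
  rw [← tensorHom_id, ← id_tensorHom]
  apply (((isCoalgHom_nabla A).tensor IsCoalgHom.id).comp (isCoalgHom_nabla A)).cofree_ext
    (IsCoalgHom.associator.comp ((IsCoalgHom.id.tensor (isCoalgHom_nabla A)).comp
      (isCoalgHom_nabla A)))
  simp only [Category.assoc, nabla_der, AdditiveCategory.comp_add, projFst, projSnd,
    tensorHom_comp_tensorHom_assoc, nabla_e, Category.id_comp, tensorHom_add, add_tensorHom,
    AdditiveCategory.add_comp]
  -- Each side is now a sum of three terms, with ε on one tensor factor and e on the other two;
  -- matching terms differ by coherence only.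
  rw [add_assoc]
  congr 1
  · monoidal
  congr 1
  · monoidal
  · monoidal

theorem isAdditiveBialgebraModality (M : MonoidalCoalgebraModality C) :
    IsAdditiveBialgebraModality M.toCoalgebraModality M.nabla M.unit where
  nab_natural := nabla_natural
  u_natural := unit_natural
  assoc := nabla_assoc
  u_nab := unit_nabla
  nab_u := nabla_unit
  comm := nabla_comm
  nab_e := nabla_e
  u_Δ := unit_Δ
  u_e := unit_e
  nab_Δ := nabla_Δ
  nab_ε := nabla_der
  map_add := map_add_eq
  map_zero := map_zero_eq

end Bialgebra

end DiffCat

/-! ### From deriving transformations to [d.∇] and [d.m]. -/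

namespace DiffCat

section Deriving

variable {C : Type u} [Category.{v} C] [MonoidalCategory C] [SymmetricCategory C]
  [AdditiveCategory C] {M : MonoidalCoalgebraModality C}
  {d : ∀ A : C, M.obj A ⊗ A ⟶ M.obj A}

/-- The map `(u ⊗ 1) ; d : A ⟶ !A`. -/
def inducedEta (M : MonoidalCoalgebraModality C) (d : ∀ A : C, M.obj A ⊗ A ⟶ M.obj A) (A : C) :
    A ⟶ M.obj A :=
  (λ_ A).inv ≫ M.unit A ▷ A ≫ d A

theorem inducedEta_natural (hd : DNatural M.toCoalgebraModality d) {A B : C} (f : A ⟶ B) :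
    f ≫ inducedEta M d B = inducedEta M d A ≫ M.map f := by
  rw [inducedEta, inducedEta, Category.assoc, Category.assoc, ← hd, ← tensorHom_id,
    ← tensorHom_id, tensorHom_comp_tensorHom_assoc, unit_natural, Category.id_comp,
    leftUnitor_inv_naturality_assoc, ← id_tensorHom, tensorHom_comp_tensorHom_assoc,
    Category.id_comp, Category.comp_id]

theorem inducedEta_der (hd : LinearRule M.toCoalgebraModality d) (A : C) :
    inducedEta M d A ≫ M.der A = 𝟙 A := by
  have h : d A ≫ M.der A = M.e A ▷ A ≫ (λ_ A).hom := hd A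
  rw [inducedEta, Category.assoc, Category.assoc, h, ← comp_whiskerRight_assoc, unit_e,
    id_whiskerRight, Category.id_comp, Iso.inv_hom_id]

/-- Naturality at the zero map gives `0 = η !(0) = η e u`, and `u e = 1` removes the u. -/
theorem inducedEta_e (hn : DNatural M.toCoalgebraModality d) (A : C) :
    inducedEta M d A ≫ M.e A = 0 := by
  have h := inducedEta_natural hn (0 : A ⟶ A) =≫ M.e A
  rw [AdditiveCategory.zero_comp, AdditiveCategory.zero_comp, map_zero_eq, Category.assoc,
    Category.assoc, unit_e, Category.comp_id] at h
  exact h.symm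

/-- Insert u in the second factor of [d.∇]: the right unit law turns one side into `d`, and the
other contains `(u ⊗ 1)d = η`. -/
theorem eq_inducedEta_comp_nabla [AdditiveMonoidal C]
    (hn : NablaRule M.toCoalgebraModality d M.nabla)
    (A : C) : d A = M.obj A ◁ inducedEta M d A ≫ M.nabla A := by
  have h := hn A
  have h2 : ((ρ_ (M.obj A)).inv ≫ M.obj A ◁ M.unit A ≫ M.nabla A) ▷ A ≫ d A = d A := by
    rw [nabla_unit, id_whiskerRight, Category.id_comp]
  rw [← h2, comp_whiskerRight, comp_whiskerRight, Category.assoc, Category.assoc, h, inducedEta]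
  monoidal

/-- A map `η` with `d = (1 ⊗ η) ; ∇` is determined by `d`. -/
theorem eq_inducedEta [AdditiveMonoidal C] {η : ∀ A : C, A ⟶ M.obj A} {A : C}
    (h : d A = M.obj A ◁ η A ≫ M.nabla A) : η A = inducedEta M d A := by
  rw [inducedEta, h, ← whisker_exchange_assoc, ← leftUnitor_inv_naturality_assoc, unit_nabla,
    Category.comp_id]

/-- The inclusion `u ⊗ η : B ⟶ !A ⊗ !B` of the second summand. -/
def inclSnd (M : MonoidalCoalgebraModality C) (A B : C) (η : B ⟶ M.obj B) :
    B ⟶ M.obj A ⊗ M.obj B :=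
  (λ_ B).inv ≫ (M.unit A ⊗ₘ η)

theorem inclSnd_projSnd {A B : C} {η : B ⟶ M.obj B} (h : η ≫ M.der B = 𝟙 B) :
    inclSnd M A B η ≫ projSnd M A B = 𝟙 B := by
  rw [inclSnd, projSnd, Category.assoc, tensorHom_comp_tensorHom_assoc, h, unit_e,
    id_tensorHom_id, Category.id_comp, Iso.inv_hom_id]

/-- Naturality pushes `f` and `g` onto the direction of differentiation, so a direction killed by
one of them kills one Leibniz term. -/
theorem leibniz_map (hn : DNatural M.toCoalgebraModality d)
    (hl : LeibnizRule M.toCoalgebraModality d) {X A B : C} (f : X ⟶ A) (g : X ⟶ B) :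
    d X ≫ M.Δ X ≫ (M.map f ⊗ₘ M.map g) =
      ((M.Δ X ≫ (M.map f ⊗ₘ M.map g)) ⊗ₘ g) ≫ (α_ _ _ _).hom ≫ M.obj A ◁ d B +
      ((M.Δ X ≫ (M.map f ⊗ₘ M.map g)) ⊗ₘ f) ≫ (α_ _ _ _).hom ≫
        M.obj A ◁ (β_ _ _).hom ≫ (α_ _ _ _).inv ≫ d A ▷ M.obj B := by
  have e1 : ∀ {Y : C} (k : X ⟶ Y), (M.Δ X ≫ (M.map f ⊗ₘ M.map g)) ⊗ₘ k =
      M.Δ X ▷ X ≫ ((M.map f ⊗ₘ M.map g) ⊗ₘ k) := fun k => by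
    rw [← tensorHom_id, tensorHom_comp_tensorHom, Category.id_comp]
  have h := hl X
  rw [reassoc_of% h, e1, e1, AdditiveCategory.add_comp, AdditiveCategory.comp_add,
    AdditiveCategory.comp_add]
  simp only [Category.assoc]
  congr 1
  · rw [associator_naturality_assoc, ← id_tensorHom, ← id_tensorHom, tensorHom_comp_tensorHom,
      tensorHom_comp_tensorHom, hn, Category.id_comp, Category.comp_id]
  · rw [associator_naturality_assoc, ← id_tensorHom, ← id_tensorHom,
      tensorHom_comp_tensorHom_assoc, BraidedCategory.braiding_naturality, Category.comp_id,
      ← Category.id_comp (M.map f), ← tensorHom_comp_tensorHom_assoc, Category.id_comp,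
      associator_inv_naturality_assoc, ← tensorHom_id (d X), ← tensorHom_id (d A),
      tensorHom_comp_tensorHom, tensorHom_comp_tensorHom, hn, Category.id_comp, Category.comp_id]

variable [AdditiveMonoidal C]

theorem inclSnd_projFst {A B : C} {η : B ⟶ M.obj B} (h : η ≫ M.e B = 0) :
    inclSnd M A B η ≫ projFst M A B = 0 := by
  rw [inclSnd, projFst, Category.assoc, tensorHom_comp_tensorHom_assoc, h, tensorHom_zero,
    AdditiveCategory.zero_comp, AdditiveCategory.comp_zero]

/-- A partial derivative without biproducts: the direction `u ⊗ η` has first projection 0 and second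
projection 1, so only the derivative in the second factor survives, and `pairCoalg_split` removes
the rest. -/
theorem pairCoalg_inclSnd_deriv (hn : DNatural M.toCoalgebraModality d)
    (hl : LeibnizRule M.toCoalgebraModality d) (hlin : LinearRule M.toCoalgebraModality d)
    (A B : C) :
    (pairCoalg M A B ⊗ₘ inclSnd M A B (inducedEta M d B)) ≫ d _ ≫ M.Δ _ ≫
      (M.map (projFst M A B) ⊗ₘ M.map (projSnd M A B)) = (α_ _ _ _).hom ≫ M.obj A ◁ d B := by
  rw [leibniz_map hn hl, AdditiveCategory.comp_add, tensorHom_comp_tensorHom_assoc,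
    tensorHom_comp_tensorHom_assoc, inclSnd_projFst (inducedEta_e hn B),
    inclSnd_projSnd (inducedEta_der hlin B), tensorHom_zero, AdditiveCategory.zero_comp,
    add_zero, pairCoalg_split, id_tensorHom_id, Category.id_comp]

theorem nablaRule_of_leibniz (hn : DNatural M.toCoalgebraModality d)
    (hl : LeibnizRule M.toCoalgebraModality d) (hlin : LinearRule M.toCoalgebraModality d) :
    NablaRule M.toCoalgebraModality d M.nabla := fun A => by
  have h := pairCoalg_inclSnd_deriv hn hl hlin A A
  -- The retraction followed by ∇ is `!` of the sum of the projections; naturality of `d` then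
  -- yields ∇ on the base and `0 + 1` on the direction.
  rw [← reassoc_of% h, ← map_add_eq, ← hn, tensorHom_comp_tensorHom_assoc, ← nabla_eq,
    AdditiveCategory.comp_add, inclSnd_projFst (inducedEta_e hn A),
    inclSnd_projSnd (inducedEta_der hlin A), zero_add, tensorHom_id]

theorem monoidalRule_of_leibniz (hn : DNatural M.toCoalgebraModality d)
    (hl : LeibnizRule M.toCoalgebraModality d) (hlin : LinearRule M.toCoalgebraModality d)
    (hch : ChainRule M.toCoalgebraModality d) : MonoidalRule M d := fun A B => by
  have key := pairCoalg_inclSnd_deriv hn hl hlin A B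
  have hlin' : d B ≫ M.der B = M.e B ▷ B ≫ (λ_ B).hom := hlin B
  have hch' : ∀ X : C, d X ≫ M.dig X =
    M.Δ X ▷ X ≫ (α_ _ _ _).hom ≫ (M.dig X ⊗ₘ d X) ≫ d (M.obj X) := hch
  -- Once `Δ_mTensor` has produced a δ, the chain rule applies; the same lemma read backwards then
  -- restores m_⊗ in the first factor.
  rw [← cancel_epi (α_ _ _ _).hom, ← reassoc_of% key, Δ_mTensor, reassoc_of% hch', ← hn,
    tensorHom_comp_tensorHom_assoc, ← Δ_mTensor]
  -- The costructure map is a comonoid morphism, so it can be copied into both factors created by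
  -- the chain rule.
  have e1 : ∀ {Y Z : C} (a : M.obj (M.obj A ⊗ M.obj B) ⟶ Y)
      (b : M.obj (M.obj A ⊗ M.obj B) ⊗ (M.obj A ⊗ M.obj B) ⟶ Z)
      (v : B ⟶ M.obj A ⊗ M.obj B), (pairCoalg M A B ⊗ₘ v) ≫ M.Δ _ ▷ _ ≫
        (α_ _ _ _).hom ≫ (a ⊗ₘ b) =
      ((M.Δ A ⊗ₘ M.Δ B) ≫ tensorμ (M.obj A) (M.obj A) (M.obj B) (M.obj B)) ▷ B ≫
        (α_ _ _ _).hom ≫ ((pairCoalg M A B ≫ a) ⊗ₘ ((pairCoalg M A B ⊗ₘ v) ≫ b)) :=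
    fun a b v => by
      rw [← tensorHom_id, tensorHom_comp_tensorHom_assoc, pairCoalg_Δ, Category.comp_id,
        ← tensorHom_comp_tensorHom, ← associator_naturality_assoc, ← tensorHom_id,
        tensorHom_comp_tensorHom_assoc, Category.id_comp, Category.assoc]
  have h1 := pairCoalg_split (M := M) A B
  have h2 := Δ_tensor_counit (M := M) A B B
  -- The first factor collapses by the retraction. The second is again the partial derivative, now
  -- followed by `ε ⊗ ε`, where the linear rule replaces `d ε` by `e ⊗ 1`.
  rw [reassoc_of% e1, reassoc_of% h1, reassoc_of% key, ← id_tensorHom,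
    tensorHom_comp_tensorHom, Category.id_comp, hlin', reassoc_of% h2]
  rfl

end Deriving

end DiffCat

/-! ### The codereliction, and from creation operators back to deriving transformations. -/

namespace DiffCat

theorem leftUnitor_inv_tensorμ {C : Type u} [Category.{v} C] [MonoidalCategory C]
    [SymmetricCategory C] (X Y A : C) :
    (X ⊗ Y) ◁ (λ_ A).inv ≫ tensorμ X Y (𝟙_ C) A ≫ (ρ_ X).hom ▷ (Y ⊗ A) = (α_ X Y A).hom := by
  rw [tensorμ, braiding_tensorUnit_right]
  monoidal

theorem rightUnitor_inv_tensorμ {C : Type u} [Category.{v} C] [MonoidalCategory C]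
    [SymmetricCategory C] (X Y A : C) :
    (X ⊗ Y) ◁ (ρ_ A).inv ≫ tensorμ X Y A (𝟙_ C) ≫ (X ⊗ A) ◁ (ρ_ Y).hom =
      (α_ X Y A).hom ≫ X ◁ (β_ Y A).hom ≫ (α_ X A Y).inv := by
  rw [tensorμ]
  monoidal

section Creation

variable {C : Type u} [Category.{v} C] [MonoidalCategory C] [SymmetricCategory C]
  [AdditiveCategory C] {M : MonoidalCoalgebraModality C}
  {d : ∀ A : C, M.obj A ⊗ A ⟶ M.obj A}

/-- The inclusion `η ⊗ u : A ⟶ !A ⊗ !B` of the first summand. -/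
def inclFst (M : MonoidalCoalgebraModality C) (A B : C) (η : A ⟶ M.obj A) :
    A ⟶ M.obj A ⊗ M.obj B :=
  (ρ_ A).inv ≫ (η ⊗ₘ M.unit B)

theorem inclFst_projFst {A B : C} {η : A ⟶ M.obj A} (h : η ≫ M.der A = 𝟙 A) :
    inclFst M A B η ≫ projFst M A B = 𝟙 A := by
  rw [inclFst, projFst, Category.assoc, tensorHom_comp_tensorHom_assoc, h, unit_e,
    id_tensorHom_id, Category.id_comp, Iso.inv_hom_id]

variable [AdditiveMonoidal C]

theorem inclFst_projSnd {A B : C} {η : A ⟶ M.obj A} (h : η ≫ M.e A = 0) :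
    inclFst M A B η ≫ projSnd M A B = 0 := by
  rw [inclFst, projSnd, Category.assoc, tensorHom_comp_tensorHom_assoc, h, zero_tensorHom,
    AdditiveCategory.zero_comp, AdditiveCategory.comp_zero]

/-- The expression in `key` is additive in `k`, since `k` is its first factor. At the sum of the two
inclusions both projections are 1, giving `η Δ`; at a single inclusion one projection is 0 and `!(0)
= e u` leaves one summand of the product rule. -/
theorem inducedEta_Δ (hn : DNatural M.toCoalgebraModality d)
    (hlin : LinearRule M.toCoalgebraModality d) (A : C) :
    inducedEta M d A ≫ M.Δ A = (ρ_ A).inv ≫ (inducedEta M d A ⊗ₘ M.unit A) +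
      (λ_ A).inv ≫ (M.unit A ⊗ₘ inducedEta M d A) := by
  set η := inducedEta M d A with hη
  have he : η ≫ M.e A = 0 := inducedEta_e hn A
  have hd : η ≫ M.der A = 𝟙 A := inducedEta_der hlin A
  have key : ∀ k : A ⟶ M.obj A ⊗ M.obj A, k ≫ inducedEta M d _ ≫ M.Δ _ ≫
      (M.map (projFst M A A) ⊗ₘ M.map (projSnd M A A)) =
      η ≫ M.Δ A ≫ (M.map (k ≫ projFst M A A) ⊗ₘ M.map (k ≫ projSnd M A A)) := fun k => by
    rw [reassoc_of% inducedEta_natural hn k, reassoc_of% M.Δ_natural k,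
      tensorHom_comp_tensorHom, M.map_comp, M.map_comp]
  have h := key (inclFst M A A η + inclSnd M A A η)
  rw [AdditiveCategory.add_comp, key, key, AdditiveCategory.add_comp, AdditiveCategory.add_comp,
    inclFst_projFst hd, inclFst_projSnd he, inclSnd_projFst he, inclSnd_projSnd hd, add_zero,
    zero_add, M.map_id, id_tensorHom_id, Category.comp_id, map_zero_eq, id_tensorHom,
    tensorHom_id] at h
  have hr : M.Δ A ≫ M.obj A ◁ M.e A = (ρ_ _).inv := by
    rw [← cancel_mono (ρ_ _).hom, Category.assoc, M.Δ_e, Iso.inv_hom_id]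
  have hl : M.Δ A ≫ M.e A ▷ M.obj A = (λ_ _).inv := by
    rw [← cancel_mono (λ_ _).hom, Category.assoc, M.e_Δ, Iso.inv_hom_id]
  rw [← h, MonoidalCategory.whiskerLeft_comp, comp_whiskerRight, reassoc_of% hr,
    reassoc_of% hl, rightUnitor_inv_naturality_assoc, leftUnitor_inv_naturality_assoc,
    MonoidalCategory.tensorHom_def, MonoidalCategory.tensorHom_def']

theorem isCodereliction_inducedEta (hn : DNatural M.toCoalgebraModality d)
    (hlin : LinearRule M.toCoalgebraModality d) (hch : ChainRule M.toCoalgebraModality d)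
    (hnab : NablaRule M.toCoalgebraModality d M.nabla) :
    IsCodereliction M.toCoalgebraModality M.nabla M.unit (inducedEta M d) where
  natural := inducedEta_natural hn
  constant := inducedEta_e hn
  product := inducedEta_Δ hn hlin
  linear := inducedEta_der hlin
  chain A := by
    have hd := eq_inducedEta_comp_nabla hnab
    have h : d A ≫ M.dig A = M.Δ A ▷ A ≫ (α_ _ _ _).hom ≫ (M.dig A ⊗ₘ d A) ≫ d (M.obj A) :=
      hch A
    change M.obj A ◁ inducedEta M d A ≫ M.nabla A ≫ M.dig A =
      (M.Δ A ⊗ₘ inducedEta M d A) ≫ (α_ _ _ _).hom ≫ M.obj A ◁ M.nabla A ≫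
        (M.dig A ⊗ₘ inducedEta M d (M.obj A)) ≫ M.nabla (M.obj A)
    rw [← Category.assoc, ← hd A, h, hd (M.obj A), MonoidalCategory.tensorHom_def (M.Δ A),
      Category.assoc, associator_naturality_right_assoc, ← whiskerLeft_comp_assoc, ← hd A,
      ← id_tensorHom, ← id_tensorHom, tensorHom_comp_tensorHom_assoc,
      tensorHom_comp_tensorHom_assoc, Category.id_comp, Category.comp_id]

theorem constantRule_of_nablaRule (hn : DNatural M.toCoalgebraModality d)
    (hnab : NablaRule M.toCoalgebraModality d M.nabla) :
    ConstantRule M.toCoalgebraModality d := fun A => by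
  rw [eq_inducedEta_comp_nabla hnab, Category.assoc, nabla_e, ← id_tensorHom,
    tensorHom_comp_tensorHom_assoc, inducedEta_e hn, tensorHom_zero, AdditiveCategory.zero_comp]

/-- The second derivative is multiplication by `(η ⊗ η)∇`, which is symmetric because ∇ is
commutative. -/
theorem interchangeRule_of_nablaRule (hnab : NablaRule M.toCoalgebraModality d M.nabla) :
    InterchangeRule M.toCoalgebraModality d := fun A => by
  have hd := eq_inducedEta_comp_nabla hnab A
  have h : d A ▷ A ≫ d A = (α_ _ _ _).hom ≫
      M.obj A ◁ ((inducedEta M d A ⊗ₘ inducedEta M d A) ≫ M.nabla A) ≫ M.nabla A := by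
    conv_lhs => enter [1]; rw [hd]
    rw [comp_whiskerRight, Category.assoc, hnab A, hd, associator_naturality_middle_assoc,
      ← whiskerLeft_comp_assoc, MonoidalCategory.tensorHom_def, Category.assoc]
  rw [h, Iso.inv_hom_id_assoc, ← whiskerLeft_comp_assoc,
    ← BraidedCategory.braiding_naturality_assoc, nabla_comm]

/-- Since `d` is multiplication by η, the bialgebra law multiplies Δ by `η Δ`. In each summand of
the product rule, u acts trivially on one factor and η acts as `d` on the other. -/
theorem leibnizRule_of_nablaRule (hn : DNatural M.toCoalgebraModality d)
    (hlin : LinearRule M.toCoalgebraModality d)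
    (hnab : NablaRule M.toCoalgebraModality d M.nabla) :
    LeibnizRule M.toCoalgebraModality d := fun A => by
  have hd := eq_inducedEta_comp_nabla hnab A
  have hu : M.obj A ◁ M.unit A ≫ M.nabla A = (ρ_ _).hom := by
    rw [← cancel_epi (ρ_ _).inv, nabla_unit, Iso.inv_hom_id]
  have e1 : ∀ {Y Z : C} (k : A ⟶ Y ⊗ Z) (f : Y ⟶ M.obj A) (g : Z ⟶ M.obj A),
      (M.Δ A ⊗ₘ (k ≫ (f ⊗ₘ g))) ≫ tensorμ (M.obj A) (M.obj A) (M.obj A) (M.obj A) ≫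
        (M.nabla A ⊗ₘ M.nabla A) =
      M.Δ A ▷ A ≫ (M.obj A ⊗ M.obj A) ◁ k ≫ tensorμ (M.obj A) (M.obj A) Y Z ≫
        ((M.obj A ◁ f ≫ M.nabla A) ⊗ₘ (M.obj A ◁ g ≫ M.nabla A)) := fun k f g => by
    rw [MonoidalCategory.tensorHom_def, MonoidalCategory.whiskerLeft_comp, Category.assoc,
      Category.assoc, tensorμ_natural_right_assoc, tensorHom_comp_tensorHom]
  -- The summand `η ⊗ u` yields the braided term of [d.2], which is listed second there; hence the
  -- swap.
  rw [AdditiveCategory.comp_add, AdditiveCategory.comp_add, add_comm]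
  conv_lhs => rw [hd]
  rw [Category.assoc, nabla_Δ, ← id_tensorHom, tensorHom_comp_tensorHom_assoc,
    Category.id_comp, inducedEta_Δ hn hlin, tensorHom_add, AdditiveCategory.add_comp, e1, e1,
    hu, ← hd, MonoidalCategory.tensorHom_def (ρ_ _).hom, MonoidalCategory.tensorHom_def' (d A),
    reassoc_of% leftUnitor_inv_tensorμ, reassoc_of% rightUnitor_inv_tensorμ]

theorem isDerivingTransformation_iff_isCreationOperator :
    IsDerivingTransformation M.toCoalgebraModality d ↔ IsCreationOperator M d where
  mp h :=
    { natural := h.natural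
      linear := h.linear
      chain := h.chain
      nabla := nablaRule_of_leibniz h.natural h.leibniz h.linear
      monoidal := monoidalRule_of_leibniz h.natural h.leibniz h.linear h.chain }
  mpr h :=
    { natural := h.natural
      constant := constantRule_of_nablaRule h.natural h.nabla
      leibniz := leibnizRule_of_nablaRule h.natural h.linear h.nabla
      linear := h.linear
      chain := h.chain
      interchange := interchangeRule_of_nablaRule h.nabla }

end Creation

end DiffCat

theorem mainTheorem3 {C : Type u} [Category.{v} C] [MonoidalCategory C] [SymmetricCategory C]
    [DiffCat.AdditiveCategory C] [DiffCat.AdditiveMonoidal C]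
    (M : DiffCat.MonoidalCoalgebraModality C) :
    DiffCat.IsAdditiveBialgebraModality M.toCoalgebraModality M.nabla M.unit ∧
    ∀ d : ∀ A : C, M.obj A ⊗ A ⟶ M.obj A,
      (DiffCat.IsDerivingTransformation M.toCoalgebraModality d →
        DiffCat.MonoidalRule M d ∧
        ∃! η : ∀ A : C, A ⟶ M.obj A,
          DiffCat.IsCodereliction M.toCoalgebraModality M.nabla M.unit η ∧
          ∀ A : C, d A = M.obj A ◁ η A ≫ M.nabla A) ∧
      (DiffCat.IsDerivingTransformation M.toCoalgebraModality d ↔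
        DiffCat.IsCreationOperator M d) := by
  refine ⟨DiffCat.isAdditiveBialgebraModality M, fun d =>
    ⟨fun h => ?_, DiffCat.isDerivingTransformation_iff_isCreationOperator⟩⟩
  have hc := DiffCat.isDerivingTransformation_iff_isCreationOperator.mp h
  exact ⟨hc.monoidal, DiffCat.inducedEta M d,
    ⟨DiffCat.isCodereliction_inducedEta hc.natural hc.linear hc.chain hc.nabla,
      DiffCat.eq_inducedEta_comp_nabla hc.nabla⟩,
    fun η hη => funext fun A => DiffCat.eq_inducedEta (hη.2 A)⟩
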